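/- Let $A_1$ be the complex Weyl algebra, i.e. the unital associative $\mathbb{C}$-algebra generated by $a$ and $a^\dagger$ subject to $[a,a^\dagger]=aa^\dagger-a^\dagger a=1$, and let $p\mapsto p^\dagger$ be the conjugate-linear involution of $A_1$ that reverses products and exchanges $a$ and $a^\dagger$. Let $$\hat A_1:=\{p\in A_1 \mid p^\dagger=-p\}$$ be the skew-hermitian Weyl algebra, a real Lie algebra under the commutator $[p,q]=pq-qp$. For $x\in\hat A_1$ put $C_{\hat A_1}(x):=\{s\in\hat A_1\mid [s,x]=0\}$, and call $x$ scalar if $x=c\cdot 1$ for some $c\in\mathbb{C}$ (then necessarily $c\in i\mathbb{R}$). **Theorem (Centralizer condition).** For every non-scalar $x\in\hat A_1$ (in particular, for every $x\in\hat A_1$ outside the center of $\hat A_1$), the centralizer $C_{\hat A_1}(x)$ is an abelian Lie subalgebra of $\hat A_1$. -/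

import Mathlib

/-- The two generators of the single-mode Weyl algebra: annihilation `a` and creation `a†`. -/
inductive WeylGen : Type
  | ann : WeylGen
  | cre : WeylGen

/-- The canonical commutation relation `a a† = a† a + 1` in the free complex algebra. -/
inductive WeylRel : FreeAlgebra ℂ WeylGen → FreeAlgebra ℂ WeylGen → Prop
  | ccr : WeylRel
      (FreeAlgebra.ι ℂ WeylGen.ann * FreeAlgebra.ι ℂ WeylGen.cre)
      (FreeAlgebra.ι ℂ WeylGen.cre * FreeAlgebra.ι ℂ WeylGen.ann + 1)

/-- The complex Weyl algebra `A₁`: the unital associative `ℂ`-algebra generated by `a`, `a†`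
subject to `[a, a†] = 1`. -/
def WeylA1 : Type := RingQuot WeylRel

namespace WeylA1

noncomputable instance : Ring WeylA1 := inferInstanceAs (Ring (RingQuot WeylRel))

noncomputable instance : Algebra ℂ WeylA1 := inferInstanceAs (Algebra ℂ (RingQuot WeylRel))

/-- The commutator bracket `[p, q] = pq - qp`. -/
noncomputable instance : LieRing WeylA1 := LieRing.ofAssociativeRing

noncomputable instance : LieAlgebra ℝ WeylA1 := LieAlgebra.ofAssociativeAlgebra

/-- The quotient map from the free algebra. -/
noncomputable def mk : FreeAlgebra ℂ WeylGen →ₐ[ℂ] WeylA1 := RingQuot.mkAlgHom ℂ WeylRel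

/-- The annihilation operator `a`. -/
noncomputable def a : WeylA1 := mk (FreeAlgebra.ι ℂ WeylGen.ann)

/-- The creation operator `a†`. -/
noncomputable def ad : WeylA1 := mk (FreeAlgebra.ι ℂ WeylGen.cre)

theorem a_mul_ad : a * ad = ad * a + 1 := by
  have h := RingQuot.mkAlgHom_rel ℂ WeylRel.ccr
  rw [map_add, map_mul, map_mul, map_one] at h
  exact h

/-- The universal property of `A₁`. -/
noncomputable def lift {B : Type*} [Ring B] [Algebra ℂ B] (p q : B) (h : p * q = q * p + 1) :
    WeylA1 →ₐ[ℂ] B :=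
  RingQuot.liftAlgHom ℂ
    ⟨FreeAlgebra.lift ℂ (fun g => WeylGen.casesOn g p q), by
      rintro _ _ ⟨⟩
      simpa using h⟩

theorem lift_a {B : Type*} [Ring B] [Algebra ℂ B] (p q : B) (h : p * q = q * p + 1) :
    lift p q h a = p := by
  refine (RingQuot.liftAlgHom_mkAlgHom_apply ℂ _ _ _).trans ?_
  simp

theorem lift_ad {B : Type*} [Ring B] [Algebra ℂ B] (p q : B) (h : p * q = q * p + 1) :
    lift p q h ad = q := by
  refine (RingQuot.liftAlgHom_mkAlgHom_apply ℂ _ _ _).trans ?_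
  simp

theorem hom_ext {B : Type*} [Ring B] [Algebra ℂ B] {f g : WeylA1 →ₐ[ℂ] B}
    (h1 : f a = g a) (h2 : f ad = g ad) : f = g := by
  apply RingQuot.ringQuot_ext' ℂ
  apply FreeAlgebra.hom_ext
  funext x
  cases x
  · exact h1
  · exact h2

/-- The opposite ring of `A₁`, with the complex-conjugate `ℂ`-algebra structure. It is only used
to define the dagger operation. -/
def ConjOp : Type := WeylA1ᵐᵒᵖ

noncomputable instance : Ring ConjOp := inferInstanceAs (Ring WeylA1ᵐᵒᵖ)

noncomputable instance : Algebra ℂ ConjOp :=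
  RingHom.toAlgebra' ((algebraMap ℂ WeylA1ᵐᵒᵖ).comp (starRingEnd ℂ))
    (fun c x => Algebra.commutes (A := WeylA1ᵐᵒᵖ) (starRingEnd ℂ c) x)

/-- The dagger operation as a homomorphism into the conjugate opposite algebra. -/
noncomputable def daggerHom : WeylA1 →ₐ[ℂ] ConjOp :=
  lift (B := ConjOp) (MulOpposite.op ad) (MulOpposite.op a) (by
    change MulOpposite.op ad * MulOpposite.op a = MulOpposite.op a * MulOpposite.op ad + 1
    rw [← MulOpposite.op_mul, ← MulOpposite.op_mul, a_mul_ad]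
    rfl)

/-- The dagger operation `p ↦ p†` on `A₁`: the conjugate-linear, multiplication-reversing map
that exchanges `a` and `a†`. -/
noncomputable def dagger (p : WeylA1) : WeylA1 := MulOpposite.unop (daggerHom p : WeylA1ᵐᵒᵖ)

theorem dagger_a : dagger a = ad :=
  congrArg (fun z : WeylA1ᵐᵒᵖ => MulOpposite.unop z) (lift_a (B := ConjOp) _ _ _)

theorem dagger_ad : dagger ad = a :=
  congrArg (fun z : WeylA1ᵐᵒᵖ => MulOpposite.unop z) (lift_ad (B := ConjOp) _ _ _)

theorem dagger_add (p q : WeylA1) : dagger (p + q) = dagger p + dagger q :=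
  congrArg (fun z : WeylA1ᵐᵒᵖ => MulOpposite.unop z) (map_add daggerHom p q)

theorem dagger_mul (p q : WeylA1) : dagger (p * q) = dagger q * dagger p :=
  congrArg (fun z : WeylA1ᵐᵒᵖ => MulOpposite.unop z) (map_mul daggerHom p q)

theorem dagger_algebraMap (c : ℂ) :
    dagger (algebraMap ℂ WeylA1 c) = algebraMap ℂ WeylA1 (starRingEnd ℂ c) :=
  congrArg (fun z : WeylA1ᵐᵒᵖ => MulOpposite.unop z) (daggerHom.commutes c)

theorem dagger_one : dagger 1 = 1 := by
  have h := dagger_algebraMap 1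
  rwa [map_one, map_one, map_one] at h

theorem dagger_zero : dagger 0 = 0 := by
  have h := dagger_algebraMap 0
  rwa [map_zero, map_zero, map_zero] at h

theorem dagger_smul (c : ℂ) (p : WeylA1) : dagger (c • p) = starRingEnd ℂ c • dagger p := by
  rw [Algebra.smul_def, dagger_mul, dagger_algebraMap, ← Algebra.commutes, Algebra.smul_def]

/-- The dagger operation is an involution. -/
theorem dagger_dagger (p : WeylA1) : dagger (dagger p) = p := by
  let F : WeylA1 →ₐ[ℂ] WeylA1 :=
    { toFun := fun p => dagger (dagger p)
      map_one' := by rw [dagger_one, dagger_one]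
      map_mul' := fun p q => by rw [dagger_mul, dagger_mul]
      map_zero' := by rw [dagger_zero, dagger_zero]
      map_add' := fun p q => by rw [dagger_add, dagger_add]
      commutes' := fun c => by rw [dagger_algebraMap, dagger_algebraMap, Complex.conj_conj] }
  have h : F = AlgHom.id ℂ WeylA1 := hom_ext
    (show dagger (dagger a) = a by rw [dagger_a, dagger_ad])
    (show dagger (dagger ad) = ad by rw [dagger_ad, dagger_a])
  exact congrArg (fun f : WeylA1 →ₐ[ℂ] WeylA1 => f p) h

theorem dagger_neg (p : WeylA1) : dagger (-p) = -dagger p := by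
  have h := dagger_smul (-1) p
  simpa using h

theorem dagger_sub (p q : WeylA1) : dagger (p - q) = dagger p - dagger q := by
  rw [sub_eq_add_neg, dagger_add, dagger_neg, ← sub_eq_add_neg]

end WeylA1

/-- The skew-hermitian Weyl algebra `Â₁`: the real Lie subalgebra of `A₁` (with the commutator
bracket `[p, q] = pq - qp`) of all `p` with `p† = -p`. -/
noncomputable def SkewWeyl : LieSubalgebra ℝ WeylA1 where
  carrier := {p | WeylA1.dagger p = -p}
  zero_mem' := by simp [WeylA1.dagger_zero]
  add_mem' := by
    intro p q hp hq
    change WeylA1.dagger p = -p at hp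
    change WeylA1.dagger q = -q at hq
    change WeylA1.dagger (p + q) = -(p + q)
    rw [WeylA1.dagger_add, hp, hq, neg_add]
  smul_mem' := by
    intro c p hp
    change WeylA1.dagger p = -p at hp
    change WeylA1.dagger (c • p) = -(c • p)
    rw [← Complex.coe_smul, WeylA1.dagger_smul, Complex.conj_ofReal, hp, smul_neg]
  lie_mem' := by
    intro p q hp hq
    change WeylA1.dagger p = -p at hp
    change WeylA1.dagger q = -q at hq
    change WeylA1.dagger ⁅p, q⁆ = -⁅p, q⁆
    rw [Ring.lie_def, WeylA1.dagger_sub, WeylA1.dagger_mul, WeylA1.dagger_mul, hp, hq]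
    noncomm_ring

namespace SkewWeyl

/-- The centralizer `C_S(T) = {s ∈ S | [s, t] = 0 for all t ∈ T}` for subsets `S, T` of `Â₁`. -/
def centralizer (S T : Set SkewWeyl) : Set SkewWeyl := {s | s ∈ S ∧ ∀ t ∈ T, ⁅s, t⁆ = 0}

/-- An element of `Â₁` is scalar if it is a (complex) multiple of the identity of `A₁`. -/
def IsScalar (x : SkewWeyl) : Prop := ∃ c : ℂ, (x : WeylA1) = algebraMap ℂ WeylA1 c

/-- Scalar elements are central in `Â₁`; hence elements outside the center are non-scalar. -/
theorem IsScalar.mem_center {x : SkewWeyl} (hx : IsScalar x) :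
    x ∈ centralizer Set.univ Set.univ := by
  obtain ⟨c, hc⟩ := hx
  refine ⟨Set.mem_univ _, fun t _ => Subtype.ext ?_⟩
  change ⁅(x : WeylA1), (t : WeylA1)⁆ = 0
  rw [hc, Ring.lie_def, Algebra.commutes, sub_self]

end SkewWeyl

/-! Skew-hermiticity plays no role: already in `A₁` the centralizer of a non-scalar `P` is
commutative. Write elements in normal order `∑ f_j(a†) a^j`, recorded as polynomials in `ℂ[X][X]`
(inner variable for `a†`, outer variable `Y` for `a`), and call the `Y`-degree the order. Leading
coefficients multiply. If `P`, `Q` have orders `n`, `m` and leading coefficients `f`, `g`, the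
coefficient of `[P, Q]` in degree `n + m - 1` is `n f g' - m g f'`. So if they commute, `g^n` and
`f^m` have zero Wronskian and `g^n = c f^m`.

Let `n > 0` and let `Q`, `R` commute with `P`. Then `D = Q^n - c P^m` has order below `n m`, while
`[D, R] = [Q^n, R]` has order exactly `(n - 1) m + ord [Q, R]` if `[Q, R] ≠ 0`. Passing from `Q` to
`D` thus strictly lowers `ord Q + ord R - ord [Q, R]`, a natural number: a contradiction by descent
(`commute_of_commute_of_pos`). If `n = 0`, the centralizer lies in the commutative algebra `ℂ[a†]`.
-/

open Polynomial

/-! ### Normal ordering and symbols. -/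

namespace WeylA1

/-- A predicate on `A₁` that contains the generators and is closed under the algebra operations
holds everywhere. -/
theorem mem_of_generators (S : Subalgebra ℂ WeylA1) (h1 : a ∈ S) (h2 : ad ∈ S) (P : WeylA1) :
    P ∈ S := by
  let F : WeylA1 →ₐ[ℂ] S := lift ⟨a, h1⟩ ⟨ad, h2⟩ (Subtype.ext a_mul_ad)
  have h : S.val.comp F = AlgHom.id ℂ WeylA1 := hom_ext
    (by rw [AlgHom.comp_apply, lift_a]; rfl) (by rw [AlgHom.comp_apply, lift_ad]; rfl)
  have h' : ((F P : S) : WeylA1) = P := congrArg (fun f : WeylA1 →ₐ[ℂ] WeylA1 => f P) h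
  exact h' ▸ (F P).2

/-- Coefficientwise differentiation on `ℂ[X][Y]`. -/
noncomputable def coeffDeriv : ℂ[X][X] →ₗ[ℂ] ℂ[X][X] :=
  Polynomial.lsum (fun j => ((monomial j : ℂ[X] →ₗ[ℂ[X]] ℂ[X][X]).restrictScalars ℂ) ∘ₗ derivative)

theorem coeffDeriv_monomial (j : ℕ) (f : ℂ[X]) :
    coeffDeriv (monomial j f) = monomial j (derivative f) := by
  simp [coeffDeriv, Polynomial.lsum, sum_monomial_index]

theorem coeff_coeffDeriv (q : ℂ[X][X]) (k : ℕ) :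
    (coeffDeriv q).coeff k = derivative (q.coeff k) := by
  induction q using Polynomial.induction_on' with
  | add p q hp hq => simp [hp, hq]
  | monomial n f =>
    rw [coeffDeriv_monomial, coeff_monomial, coeff_monomial]
    split_ifs <;> simp

theorem natDegree_coeffDeriv_le (q : ℂ[X][X]) : (coeffDeriv q).natDegree ≤ q.natDegree :=
  natDegree_le_iff_coeff_eq_zero.2 fun k hk => by
    rw [coeff_coeffDeriv, coeff_eq_zero_of_natDegree_lt hk, derivative_zero]

/-- The operator `Y + d/dX` on `ℂ[X][Y]`, through which `a` acts. -/
noncomputable def annOp : Module.End ℂ ℂ[X][X] := LinearMap.mulLeft ℂ X + coeffDeriv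

theorem annOp_apply (q : ℂ[X][X]) : annOp q = X * q + coeffDeriv q := rfl

/-- The action of `A₁` on symbols: `a` acts as `Y + d/dX`, `a†` as multiplication by `X`. -/
noncomputable def symbolRep : WeylA1 →ₐ[ℂ] Module.End ℂ ℂ[X][X] :=
  lift annOp (LinearMap.mulLeft ℂ (C X)) (by
    ext1 q
    ext k : 1
    simp only [Module.End.mul_apply, LinearMap.mulLeft_apply, LinearMap.add_apply,
      Module.End.one_apply, annOp_apply, coeff_add, coeff_coeffDeriv, coeff_C_mul,
      derivative_mul, derivative_X, mul_add, mul_left_comm (X : ℂ[X][X]) (C X)]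
    ring)

theorem symbolRep_a : symbolRep a = annOp := lift_a _ _ _

theorem symbolRep_ad : symbolRep ad = LinearMap.mulLeft ℂ (C X) := lift_ad _ _ _

theorem symbolRep_aeval_ad (f : ℂ[X]) :
    symbolRep (aeval ad f) = LinearMap.mulLeft ℂ (C f) := by
  induction f using Polynomial.induction_on with
  | C c =>
    ext1 q
    simp [Algebra.smul_def, Polynomial.algebraMap_apply]
  | add p q hp hq =>
    rw [map_add, map_add, hp, hq, C_add]
    exact LinearMap.ext fun r => (add_mul _ _ _).symm
  | monomial n c h =>
    rw [pow_succ, ← mul_assoc, map_mul, map_mul, h, aeval_X, symbolRep_ad]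
    exact LinearMap.ext fun r => by simp [mul_assoc]

/-- Normal ordering: the element of `A₁` with symbol `∑ f_j Y^j` is `∑ f_j(a†) a^j`. -/
noncomputable def normalOrder : ℂ[X][X] →ₗ[ℂ] WeylA1 :=
  Polynomial.lsum (fun j => LinearMap.mulRight ℂ (a ^ j) ∘ₗ (aeval ad : ℂ[X] →ₐ[ℂ] WeylA1).toLinearMap)

theorem normalOrder_monomial (j : ℕ) (f : ℂ[X]) :
    normalOrder (monomial j f) = aeval ad f * a ^ j := by
  simp [normalOrder, Polynomial.lsum, sum_monomial_index]

/-- The commutator with `a` is a derivation sending `a†` to `1`; this is the source of `d/dX` in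
`annOp`. -/
theorem a_mul_aeval_ad (f : ℂ[X]) :
    a * aeval ad f = aeval ad f * a + aeval ad (derivative f) := by
  induction f using Polynomial.induction_on with
  | C c => simp [Algebra.commutes]
  | add p q hp hq => simp only [map_add, mul_add, add_mul, hp, hq]; abel
  | monomial n c h =>
    rw [pow_succ, ← mul_assoc]
    generalize C c * X ^ n = g at h ⊢
    rw [derivative_mul, derivative_X, mul_one, map_mul, aeval_X, map_add,
      map_mul, aeval_X, ← mul_assoc, h, add_mul, mul_assoc, a_mul_ad, mul_add, mul_one, ← mul_assoc]
    abel

theorem normalOrder_annOp (q : ℂ[X][X]) : normalOrder (annOp q) = a * normalOrder q := by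
  induction q using Polynomial.induction_on' with
  | add p q hp hq => simp only [map_add, mul_add, hp, hq]
  | monomial n f =>
    rw [annOp_apply, X_mul_monomial, coeffDeriv_monomial, map_add, normalOrder_monomial,
      normalOrder_monomial, normalOrder_monomial, ← mul_assoc, a_mul_aeval_ad, add_mul, pow_succ',
      mul_assoc]

theorem normalOrder_C_X_mul (q : ℂ[X][X]) : normalOrder (C X * q) = ad * normalOrder q := by
  induction q using Polynomial.induction_on' with
  | add p q hp hq => rw [mul_add, map_add, map_add, mul_add, hp, hq]
  | monomial n f =>
    rw [C_mul_monomial, normalOrder_monomial, normalOrder_monomial, map_mul, aeval_X, mul_assoc]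

/-- The `P` with this property form a subalgebra, so the generators suffice. Taking `q = 1` makes
`normalOrder` a left inverse of `symbol`. -/
theorem normalOrder_symbolRep (P : WeylA1) (q : ℂ[X][X]) :
    normalOrder (symbolRep P q) = P * normalOrder q := by
  let S : Subalgebra ℂ WeylA1 :=
    { carrier := {P | ∀ q, normalOrder (symbolRep P q) = P * normalOrder q}
      mul_mem' := fun {P Q} hP hQ q => by
        rw [map_mul, Module.End.mul_apply, hP, hQ, mul_assoc]
      add_mem' := fun {P Q} hP hQ q => by
        rw [map_add, LinearMap.add_apply, map_add, hP, hQ, add_mul]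
      algebraMap_mem' := fun c q => by
        rw [AlgHom.commutes, Module.algebraMap_end_apply, map_smul, Algebra.smul_def] }
  refine mem_of_generators S (fun q => ?_) (fun q => ?_) P q
  · rw [symbolRep_a, normalOrder_annOp]
  · rw [symbolRep_ad, LinearMap.mulLeft_apply, normalOrder_C_X_mul]

/-- The normally ordered symbol of an element of `A₁`. -/
noncomputable def symbol : WeylA1 →ₗ[ℂ] ℂ[X][X] where
  toFun P := symbolRep P 1
  map_add' P Q := by rw [map_add, LinearMap.add_apply]
  map_smul' c P := by rw [map_smul, LinearMap.smul_apply, RingHom.id_apply]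

theorem symbol_apply (P : WeylA1) : symbol P = symbolRep P 1 := rfl

theorem normalOrder_symbol (P : WeylA1) : normalOrder (symbol P) = P := by
  have h := normalOrder_monomial 0 1
  rw [monomial_zero_one, map_one (aeval ad), pow_zero, mul_one] at h
  rw [symbol_apply, normalOrder_symbolRep, h, mul_one]

theorem symbol_injective : Function.Injective symbol :=
  Function.LeftInverse.injective normalOrder_symbol

/-- Since `P = ∑ f_j(a†) a^j`, it acts on the symbol of `Q` as `∑ f_j (Y + d/dX)^j`. -/
theorem symbol_mul (P Q : WeylA1) :
    symbol (P * Q) = (symbol P).sum fun j f => C f * (annOp ^ j) (symbol Q) := by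
  have h : ∀ p q : ℂ[X][X],
      symbolRep (normalOrder p) q = p.sum fun j f => C f * (annOp ^ j) q := by
    intro p q
    induction p using Polynomial.induction_on' with
    | add p₁ p₂ h₁ h₂ =>
      rw [map_add, map_add, LinearMap.add_apply, h₁, h₂, sum_add_index]
      · simp
      · intro j f g
        rw [C_add, add_mul]
    | monomial n f =>
      rw [normalOrder_monomial, map_mul, map_pow, symbolRep_a, symbolRep_aeval_ad,
        sum_monomial_index _ _ (by simp)]
      rfl
  rw [symbol_apply, map_mul, Module.End.mul_apply, ← symbol_apply Q, ← h, normalOrder_symbol]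

/-! ### Leading and subleading coefficients of a product. -/

theorem natDegree_annOp_pow_le {q : ℂ[X][X]} {m : ℕ} (hq : q.natDegree ≤ m) (j : ℕ) :
    ((annOp ^ j) q).natDegree ≤ j + m := by
  induction j with
  | zero => simpa using hq
  | succ j ih =>
    rw [pow_succ', Module.End.mul_apply, annOp_apply]
    refine natDegree_add_le_of_degree_le (natDegree_mul_le.trans ?_)
      ((natDegree_coeffDeriv_le _).trans (by omega))
    rw [natDegree_X]
    omega

theorem coeff_annOp_pow {q : ℂ[X][X]} {m : ℕ} (hq : q.natDegree ≤ m) (j : ℕ) :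
    ((annOp ^ j) q).coeff (j + m) = q.coeff m := by
  induction j with
  | zero => simp
  | succ j ih =>
    rw [pow_succ', Module.End.mul_apply, annOp_apply, coeff_add, coeff_coeffDeriv,
      coeff_eq_zero_of_natDegree_lt (n := j + 1 + m)
        ((natDegree_annOp_pow_le hq j).trans_lt (by omega)),
      show j + 1 + m = j + m + 1 by omega, coeff_X_mul, ih, derivative_zero, add_zero]

/-- The subleading coefficient. Multiplying by the variable shifts the index by one, and makes the
statement meaningful in degree `0`. -/
theorem coeff_X_mul_annOp_pow {q : ℂ[X][X]} {m : ℕ} (hq : q.natDegree ≤ m) (j : ℕ) :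
    (X * (annOp ^ j) q).coeff (j + m) = (X * q).coeff m + j * derivative (q.coeff m) := by
  induction j with
  | zero => simp
  | succ j ih =>
    rw [pow_succ', Module.End.mul_apply, annOp_apply, show j + 1 + m = j + m + 1 by omega,
      coeff_X_mul, coeff_add, coeff_coeffDeriv, ih, coeff_annOp_pow hq]
    push_cast
    ring

theorem natDegree_symbol_mul_le {P Q : WeylA1} {n m : ℕ} (hP : (symbol P).natDegree ≤ n)
    (hQ : (symbol Q).natDegree ≤ m) : (symbol (P * Q)).natDegree ≤ n + m := by
  rw [symbol_mul, sum_over_range' _ (by simp) (n + 1) (by omega)]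
  refine natDegree_sum_le_of_forall_le _ _ fun j hj => (natDegree_C_mul_le _ _).trans ?_
  rw [Finset.mem_range] at hj
  exact (natDegree_annOp_pow_le hQ j).trans (by omega)

/-- Each `annOp` raises the degree by at most one, so only the term `j = n` reaches degree `n + m`.
-/
theorem coeff_symbol_mul {P Q : WeylA1} {n m : ℕ} (hP : (symbol P).natDegree ≤ n)
    (hQ : (symbol Q).natDegree ≤ m) :
    (symbol (P * Q)).coeff (n + m) = (symbol P).coeff n * (symbol Q).coeff m := by
  rw [symbol_mul, sum_over_range' _ (by simp) (n + 1) (by omega), finsetSum_coeff,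
    Finset.sum_range_succ, coeff_C_mul, coeff_annOp_pow hQ, add_eq_right]
  refine Finset.sum_eq_zero fun j hj => ?_
  rw [Finset.mem_range] at hj
  rw [coeff_C_mul, coeff_eq_zero_of_natDegree_lt
    ((natDegree_annOp_pow_le hQ j).trans_lt (by omega)), mul_zero]

/-- Degree `n + m - 1` is reached only by `j = n`, through the subleading coefficient of `annOp ^
n`, and by `j = n - 1`, through the leading one. The first two summands together are symmetric in
`P` and `Q`; the derivative term is what a commutator sees. -/
theorem coeff_X_mul_symbol_mul {P Q : WeylA1} {n m : ℕ} (hP : (symbol P).natDegree ≤ n)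
    (hQ : (symbol Q).natDegree ≤ m) :
    (X * symbol (P * Q)).coeff (n + m) =
      (symbol P).coeff n * (X * symbol Q).coeff m + (X * symbol P).coeff n * (symbol Q).coeff m +
        n * ((symbol P).coeff n * derivative ((symbol Q).coeff m)) := by
  rw [symbol_mul, sum_over_range' _ (by simp) (n + 1) (by omega), Finset.mul_sum, finsetSum_coeff,
    Finset.sum_range_succ, mul_left_comm, coeff_C_mul, coeff_X_mul_annOp_pow hQ]
  have h : ∑ j ∈ Finset.range n,
      (X * (C ((symbol P).coeff j) * (annOp ^ j) (symbol Q))).coeff (n + m) =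
        (X * symbol P).coeff n * (symbol Q).coeff m := by
    cases n with
    | zero => simp
    | succ n =>
      rw [Finset.sum_range_succ, show n + 1 + m = n + m + 1 by omega, coeff_X_mul, coeff_X_mul,
        coeff_C_mul, coeff_annOp_pow hQ, add_eq_right]
      refine Finset.sum_eq_zero fun j hj => ?_
      rw [Finset.mem_range] at hj
      rw [coeff_X_mul, coeff_C_mul, coeff_eq_zero_of_natDegree_lt
        ((natDegree_annOp_pow_le hQ j).trans_lt (by omega)), mul_zero]
  rw [h]
  ring

end WeylA1

/-! ### Polynomials with vanishing Wronskian. -/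

/-- The operator `X d/dX` multiplies the leading coefficient by the degree; compare top coefficients
after multiplying `h` by `X`. -/
theorem Polynomial.natDegree_eq_of_derivative_mul_eq {u v : ℂ[X]} (hu : u ≠ 0) (hv : v ≠ 0)
    (h : derivative u * v = u * derivative v) : u.natDegree = v.natDegree := by
  have key : ∀ p : ℂ[X], (X * derivative p).coeff p.natDegree = p.natDegree * p.leadingCoeff := by
    intro p
    cases hp : p.natDegree with
    | zero => simp
    | succ k =>
      rw [coeff_X_mul, coeff_derivative, leadingCoeff, hp]
      push_cast
      ring
  have hdeg : ∀ p : ℂ[X], (X * derivative p).natDegree ≤ p.natDegree := by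
    intro p
    refine natDegree_le_iff_coeff_eq_zero.2 fun k hk => ?_
    obtain ⟨k, rfl⟩ := Nat.exists_eq_succ_of_ne_zero (Nat.ne_zero_of_lt hk)
    rw [Nat.succ_eq_add_one, coeff_X_mul, coeff_derivative, coeff_eq_zero_of_natDegree_lt hk,
      zero_mul]
  have h' : (X * derivative u * v).coeff (u.natDegree + v.natDegree) =
      (u * (X * derivative v)).coeff (u.natDegree + v.natDegree) := by
    rw [mul_assoc, h, mul_left_comm]
  rw [coeff_mul_add_eq_of_natDegree_le (hdeg u) le_rfl,
    coeff_mul_add_eq_of_natDegree_le le_rfl (hdeg v), key, key, coeff_natDegree, coeff_natDegree] at h'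
  have h0 : (u.natDegree - v.natDegree : ℂ) * (u.leadingCoeff * v.leadingCoeff) = 0 := by
    linear_combination h'
  rcases mul_eq_zero.1 h0 with h1 | h1
  · exact_mod_cast sub_eq_zero.1 h1
  · exact absurd h1 (mul_ne_zero (leadingCoeff_ne_zero.2 hu) (leadingCoeff_ne_zero.2 hv))

/-- Nonzero complex polynomials with vanishing Wronskian are proportional. -/
theorem Polynomial.exists_eq_C_mul_of_derivative_mul_eq {u v : ℂ[X]} (hu : u ≠ 0) (hv : v ≠ 0)
    (h : derivative u * v = u * derivative v) : ∃ c : ℂ, u = C c * v := by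
  have hd := natDegree_eq_of_derivative_mul_eq hu hv h
  have hlv : v.leadingCoeff ≠ 0 := leadingCoeff_ne_zero.2 hv
  refine ⟨u.leadingCoeff / v.leadingCoeff, ?_⟩
  -- The difference `u - c v` also has zero Wronskian with `v`, so if nonzero it has the degree of
  -- `v`; but `c` was chosen to cancel the coefficient there.
  by_contra hne
  rw [← sub_eq_zero] at hne
  have hd' := natDegree_eq_of_derivative_mul_eq hne hv (by
    rw [derivative_sub, derivative_C_mul]
    linear_combination h)
  apply hne
  rw [← leadingCoeff_eq_zero, leadingCoeff, hd', coeff_sub, coeff_C_mul, coeff_natDegree,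
    div_mul_cancel₀ _ hlv, ← hd, coeff_natDegree, sub_self]

/-! ### Principal parts and commuting elements. -/

namespace WeylA1

/-- `P` has order at most `n`, and its part of order `n` is `f(a†) aⁿ`. -/
def HasPrincipalPart (P : WeylA1) (n : ℕ) (f : ℂ[X]) : Prop :=
  (symbol P).natDegree ≤ n ∧ (symbol P).coeff n = f

namespace HasPrincipalPart

variable {P Q : WeylA1} {n m : ℕ} {f g : ℂ[X]}

theorem self (P : WeylA1) :
    HasPrincipalPart P (symbol P).natDegree (symbol P).leadingCoeff := ⟨le_rfl, rfl⟩

theorem mul (hP : HasPrincipalPart P n f) (hQ : HasPrincipalPart Q m g) :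
    HasPrincipalPart (P * Q) (n + m) (f * g) :=
  ⟨natDegree_symbol_mul_le hP.1 hQ.1, by rw [coeff_symbol_mul hP.1 hQ.1, hP.2, hQ.2]⟩

theorem add (hP : HasPrincipalPart P n f) (hQ : HasPrincipalPart Q n g) :
    HasPrincipalPart (P + Q) n (f + g) :=
  ⟨by rw [map_add]; exact natDegree_add_le_of_degree_le hP.1 hQ.1,
    by rw [map_add, coeff_add, hP.2, hQ.2]⟩

theorem sub (hP : HasPrincipalPart P n f) (hQ : HasPrincipalPart Q n g) :
    HasPrincipalPart (P - Q) n (f - g) :=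
  ⟨by rw [map_sub]; exact (natDegree_sub_le _ _).trans (max_le hP.1 hQ.1),
    by rw [map_sub, coeff_sub, hP.2, hQ.2]⟩

theorem scalar (c : ℂ) : HasPrincipalPart (algebraMap ℂ WeylA1 c) 0 (C c) := by
  have h : symbol (algebraMap ℂ WeylA1 c) = C (C c) := by
    rw [symbol_apply, AlgHom.commutes, Module.algebraMap_end_apply, Algebra.smul_def, mul_one]
    rfl
  exact ⟨by rw [h, natDegree_C], by rw [h, coeff_C_zero]⟩

theorem pow (hP : HasPrincipalPart P n f) (k : ℕ) :
    HasPrincipalPart (P ^ k) (k * n) (f ^ k) := by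
  induction k with
  | zero => simpa using scalar 1
  | succ k ih =>
    rw [pow_succ, pow_succ, add_mul, one_mul]
    exact ih.mul hP

theorem natDegree_eq (hP : HasPrincipalPart P n f) (hf : f ≠ 0) : (symbol P).natDegree = n :=
  natDegree_eq_of_le_of_coeff_ne_zero hP.1 (hP.2.symm ▸ hf)

/-- Compare the subleading coefficients of `P * Q` and `Q * P`: the symmetric terms cancel. -/
theorem derivative_eq_of_commute (hP : HasPrincipalPart P n f) (hQ : HasPrincipalPart Q m g)
    (h : Commute P Q) : n * (f * derivative g) = m * (g * derivative f) := by
  have h1 := coeff_X_mul_symbol_mul hP.1 hQ.1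
  have h2 := coeff_X_mul_symbol_mul hQ.1 hP.1
  rw [h.eq, add_comm n m, h2, hP.2, hQ.2] at h1
  linear_combination -h1

/-- Powers of the principal parts of commuting elements are proportional. -/
theorem exists_pow_eq_C_mul_pow (hP : HasPrincipalPart P n f) (hQ : HasPrincipalPart Q m g)
    (h : Commute P Q) (hf : f ≠ 0) (hg : g ≠ 0) : ∃ c : ℂ, g ^ n = C c * f ^ m := by
  refine exists_eq_C_mul_of_derivative_mul_eq (pow_ne_zero _ hg) (pow_ne_zero _ hf) ?_
  have key := derivative_eq_of_commute hP hQ h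
  -- The extra factor `p` avoids the exponent `k - 1`; hence the cancellation of `f * g` below.
  have e : ∀ (p : ℂ[X]) (k : ℕ), p * derivative (p ^ k) = k * p ^ k * derivative p := by
    intro p k
    cases k with
    | zero => simp
    | succ k => rw [derivative_pow_succ]; push_cast; simp only [C_add, C_1, map_natCast]; ring
  refine mul_left_cancel₀ (mul_ne_zero hf hg) ?_
  have e1 := e g n
  have e2 := e f m
  linear_combination f * f ^ m * e1 - g * g ^ n * e2 + g ^ n * f ^ m * key

/-- The principal part of `[Qᵏ⁺¹, R]`. -/
theorem pow_succ_commutator {R : WeylA1} {d : ℕ} {r : ℂ[X]} (hQ : HasPrincipalPart Q m g)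
    (h : HasPrincipalPart (Q * R - R * Q) d r) (k : ℕ) :
    HasPrincipalPart (Q ^ (k + 1) * R - R * Q ^ (k + 1)) (k * m + d) ((k + 1) * g ^ k * r) := by
  induction k with
  | zero => simpa using h
  | succ k ih =>
    -- Leibniz rule; the two terms contribute `1` and `k + 1` times `g ^ (k + 1) * r`.
    have e : Q ^ (k + 1 + 1) * R - R * Q ^ (k + 1 + 1) =
        Q ^ (k + 1) * (Q * R - R * Q) + (Q ^ (k + 1) * R - R * Q ^ (k + 1)) * Q := by
      rw [pow_succ Q (k + 1)]
      noncomm_ring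
    have h1 := (hQ.pow (k + 1)).mul h
    have h2 := ih.mul hQ
    rw [show k * m + d + m = (k + 1) * m + d by ring] at h2
    rw [e]
    convert h1.add h2 using 1
    push_cast
    ring

end HasPrincipalPart

theorem natDegree_symbol_commutator_le (P Q : WeylA1) :
    (symbol (P * Q - Q * P)).natDegree ≤ (symbol P).natDegree + (symbol Q).natDegree := by
  rw [map_sub]
  refine (natDegree_sub_le _ _).trans (max_le (natDegree_symbol_mul_le le_rfl le_rfl) ?_)
  rw [add_comm]
  exact natDegree_symbol_mul_le le_rfl le_rfl

theorem symbol_ne_zero {P : WeylA1} (h : P ≠ 0) : symbol P ≠ 0 :=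
  (map_ne_zero_iff _ symbol_injective).2 h

/-- Elements of order `0` are polynomials in `a†`. -/
theorem commute_of_natDegree_symbol_eq_zero {P Q : WeylA1} (hP : (symbol P).natDegree = 0)
    (hQ : (symbol Q).natDegree = 0) : Commute P Q := by
  have e : ∀ R : WeylA1, (symbol R).natDegree = 0 → R = aeval ad ((symbol R).coeff 0) := by
    intro R hR
    have h := normalOrder_monomial 0 ((symbol R).coeff 0)
    rwa [monomial_zero_left, ← eq_C_of_natDegree_eq_zero hR, normalOrder_symbol, pow_zero,
      mul_one] at h
  rw [e P hP, e Q hQ]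
  exact Commute.map (Commute.all _ _) (aeval ad : ℂ[X] →ₐ[ℂ] WeylA1)

theorem eq_algebraMap_of_symbol {P : WeylA1} {c : ℂ} (h : symbol P = C (C c)) :
    P = algebraMap ℂ WeylA1 c := by
  rw [← normalOrder_symbol P, h, ← monomial_zero_left, normalOrder_monomial, aeval_C, pow_zero,
    mul_one]

/-- An element that commutes with a non-scalar element of order `0` has order `0`. -/
theorem natDegree_symbol_eq_zero_of_commute {P Q : WeylA1} (hP : (symbol P).natDegree = 0)
    (hs : ¬ ∃ c : ℂ, P = algebraMap ℂ WeylA1 c) (h : Commute P Q) :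
    (symbol Q).natDegree = 0 := by
  by_contra hQ
  have key := (HasPrincipalPart.self P).derivative_eq_of_commute (HasPrincipalPart.self Q) h
  -- For `n = 0` the identity reads `m g f' = 0`, and `f' = 0` would make `P` scalar.
  rw [hP, Nat.cast_zero, zero_mul, eq_comm, mul_eq_zero, mul_eq_zero, leadingCoeff_eq_zero] at key
  rcases key with h1 | h1 | h1
  · exact hQ (by exact_mod_cast h1)
  · exact hQ (by rw [h1, natDegree_zero])
  · refine hs ⟨_, eq_algebraMap_of_symbol (c := (symbol P).leadingCoeff.coeff 0) ?_⟩
    rw [← eq_C_of_natDegree_eq_zero (derivative_eq_zero.1 h1), leadingCoeff, hP]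
    exact eq_C_of_natDegree_eq_zero hP

/-- Elements that commute with an element of positive order commute with each other: otherwise
the order drop `ord Q + ord R - ord [Q, R]` could be decreased indefinitely by replacing `Q` with
`Qⁿ - c Pᵐ`. -/
theorem commute_of_commute_of_pos {P R : WeylA1} (hP : 0 < (symbol P).natDegree)
    (hR : Commute P R) (t : ℕ) (Q : WeylA1) (hQ : Commute P Q)
    (ht : (symbol Q).natDegree + (symbol R).natDegree = (symbol (Q * R - R * Q)).natDegree + t) :
    Commute Q R := by
  induction t using Nat.strong_induction_on generalizing Q with
  | _ t ih =>
  by_contra hne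
  have hcomm : Q * R - R * Q ≠ 0 := fun h => hne (sub_eq_zero.1 h)
  have hQ0 : Q ≠ 0 := by
    rintro rfl
    exact hne (Commute.zero_left R)
  have hP0 : symbol P ≠ 0 := by
    intro h
    rw [h, natDegree_zero] at hP
    exact hP.false
  have pP := HasPrincipalPart.self P
  have pQ := HasPrincipalPart.self Q
  have pB := HasPrincipalPart.self (Q * R - R * Q)
  have lP := leadingCoeff_ne_zero.2 hP0
  have lQ := leadingCoeff_ne_zero.2 (symbol_ne_zero hQ0)
  have lB := leadingCoeff_ne_zero.2 (symbol_ne_zero hcomm)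
  obtain ⟨c, hc⟩ := pP.exists_pow_eq_C_mul_pow pQ hQ lP lQ
  generalize (symbol P).natDegree = n at *
  generalize (symbol Q).natDegree = m at *
  obtain ⟨k, rfl⟩ : ∃ k, n = k + 1 := ⟨n - 1, by omega⟩
  let c' := algebraMap ℂ WeylA1 c
  have hcR : Commute (c' * P ^ m) R :=
    Commute.mul_left (Algebra.commutes c R) (hR.pow_left m)
  have hcP : Commute P (c' * P ^ m) :=
    Commute.mul_right (Algebra.commutes c P).symm ((Commute.refl P).pow_right m)
  -- Subtracting `c P ^ m`, which commutes with `R`, leaves the commutator unchanged.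
  have e : Q ^ (k + 1) * R - R * Q ^ (k + 1) =
      (Q ^ (k + 1) - c' * P ^ m) * R - R * (Q ^ (k + 1) - c' * P ^ m) := by
    rw [sub_mul, mul_sub, hcR.eq]
    abel
  have pB' := pQ.pow_succ_commutator pB k
  rw [e] at pB'
  have hB' := pB'.natDegree_eq
    (mul_ne_zero (mul_ne_zero (Nat.cast_add_one_ne_zero k) (pow_ne_zero _ lQ)) lB)
  -- The zero principal part records that the top coefficients cancel, by the choice of `c`.
  have pD : HasPrincipalPart (Q ^ (k + 1) - c' * P ^ m) ((k + 1) * m) 0 := by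
    have h := (HasPrincipalPart.scalar c).mul (pP.pow m)
    rw [zero_add, mul_comm m, ← hc] at h
    simpa using (pQ.pow (k + 1)).sub h
  -- The commutator with `R` has a nonzero principal part. This excludes the zero symbol, whose
  -- `natDegree` is `0` by convention and would spoil the strict inequality when `m = 0`.
  have hD : symbol (Q ^ (k + 1) - c' * P ^ m) ≠ 0 := by
    refine symbol_ne_zero fun h => ?_
    rw [h, zero_mul, mul_zero, sub_zero] at pB'
    refine mul_ne_zero (mul_ne_zero (Nat.cast_add_one_ne_zero k) (pow_ne_zero k lQ)) lB ?_
    rw [← pB'.2, map_zero, coeff_zero]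
  have hlt : (symbol (Q ^ (k + 1) - c' * P ^ m)).natDegree < (k + 1) * m := by
    refine lt_of_le_of_ne pD.1 fun h => hD (leadingCoeff_eq_zero.1 ?_)
    rw [leadingCoeff, h, pD.2]
  have hle : (symbol ((Q ^ (k + 1) - c' * P ^ m) * R - R * (Q ^ (k + 1) - c' * P ^ m))).natDegree ≤
      (symbol (Q ^ (k + 1) - c' * P ^ m)).natDegree + (symbol R).natDegree :=
    natDegree_symbol_commutator_le _ _
  obtain ⟨t', ht'⟩ := Nat.exists_eq_add_of_le hle
  have hm : (k + 1) * m = k * m + m := by ring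
  -- Here `t' < t`: the commutator gained exactly `k * m` in order, while the first factor gained
  -- less than `k * m`.
  have hfin := ih t' (by omega) _ ((hQ.pow_right (k + 1)).sub_right hcP) ht'
  have h0 := pB'.2
  rw [hfin.eq, sub_self, map_zero, coeff_zero] at h0
  exact mul_ne_zero (mul_ne_zero (Nat.cast_add_one_ne_zero k) (pow_ne_zero k lQ)) lB h0.symm

/-- The centralizer of a non-scalar element of `A₁` is commutative. -/
theorem commute_of_commute {P Q R : WeylA1} (hs : ¬ ∃ c : ℂ, P = algebraMap ℂ WeylA1 c)
    (hQ : Commute P Q) (hR : Commute P R) : Commute Q R := by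
  rcases Nat.eq_zero_or_pos (symbol P).natDegree with h | h
  · exact commute_of_natDegree_symbol_eq_zero (natDegree_symbol_eq_zero_of_commute h hs hQ)
      (natDegree_symbol_eq_zero_of_commute h hs hR)
  · have hle : (symbol (Q * R - R * Q)).natDegree ≤
        (symbol Q).natDegree + (symbol R).natDegree :=
      natDegree_symbol_commutator_le _ _
    obtain ⟨t, ht⟩ := Nat.exists_eq_add_of_le hle
    exact commute_of_commute_of_pos h hR t Q hQ ht

end WeylA1

namespace SkewWeyl

theorem lie_eq_zero_iff_commute (s t : SkewWeyl) :
    ⁅s, t⁆ = 0 ↔ Commute (s : WeylA1) (t : WeylA1) := by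
  rw [← Subtype.coe_inj]
  change ⁅(s : WeylA1), (t : WeylA1)⁆ = 0 ↔ _
  rw [Ring.lie_def, sub_eq_zero]
  rfl

end SkewWeyl

theorem mainTheorem8 (x : SkewWeyl) (hx : ¬ SkewWeyl.IsScalar x) :
    ∃ L : LieSubalgebra ℝ SkewWeyl,
      (L : Set SkewWeyl) = SkewWeyl.centralizer Set.univ {x} ∧ IsLieAbelian L := by
  let L : LieSubalgebra ℝ SkewWeyl :=
    { carrier := {s | ⁅s, x⁆ = 0}
      zero_mem' := zero_lie x
      add_mem' := fun {s t} (hs : ⁅s, x⁆ = 0) (ht : ⁅t, x⁆ = 0) =>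
        show ⁅s + t, x⁆ = 0 by rw [add_lie, hs, ht, add_zero]
      smul_mem' := fun c s (hs : ⁅s, x⁆ = 0) =>
        show ⁅c • s, x⁆ = 0 by rw [smul_lie, hs, smul_zero]
      lie_mem' := fun {s t} (hs : ⁅s, x⁆ = 0) (ht : ⁅t, x⁆ = 0) =>
        show ⁅⁅s, t⁆, x⁆ = 0 by rw [lie_lie, hs, ht, lie_zero, lie_zero, sub_zero] }
  refine ⟨L, ?_, ⟨fun s t => Subtype.ext ?_⟩⟩
  · ext s
    change ⁅s, x⁆ = 0 ↔ s ∈ Set.univ ∧ ∀ t ∈ ({x} : Set SkewWeyl), ⁅s, t⁆ = 0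
    simp
  · exact (SkewWeyl.lie_eq_zero_iff_commute _ _).2 (WeylA1.commute_of_commute hx
      ((SkewWeyl.lie_eq_zero_iff_commute _ _).1 s.2).symm
      ((SkewWeyl.lie_eq_zero_iff_commute _ _).1 t.2).symm)
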